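/- Let $\beta,\gamma\in(0,1)$. Let $(X_k)_{k\ge1}$ be i.i.d. nonnegative random variables whose tail $\bar F(x)=\mathbb P[X_1>x]$ is regularly varying with index $-\beta$, that is, $\lim_{x\to\infty}\bar F(\Lambda x)/\bar F(x)=\Lambda^{-\beta}$ for every $\Lambda>0$. Let $(N(t))_{t\ge0}$ be a process with values in $\{0,1,2,\dots\}$ (possibly with $\mathbb E[N(t)]=\infty$) such that each $N(t)$ is independent of $(X_k)_{k\ge1}$, with generating functions $\phi_{N(t)}(z)=\sum_{n\ge0}\mathbb P[N(t)=n]z^n$, and put $S_{N(t)}=\sum_{k=1}^{N(t)}X_k$ (with $S_0=0$). Suppose there are positive families $(C_t)_{t\ge0}$ and $(z_t)_{t\ge0}$ with $z_t\to1$ as $t\to\infty$ such that, for $z\in[0,1)$ and $t\ge0$, $$\phi_{N(t)}(z)=1-C_t(1-z)^\gamma+\mathcal E_t(1-z),$$ where for every $\lambda>0$ $$\lim_{t\to\infty}\ \sup_{\substack{z\in[0,1)\\ 1-z\le\lambda(1-z_t)}}\left|\frac{\mathcal E_t(1-z)}{C_t(1-z)^\gamma}\right|=0 .$$ Let $(x_t)_{t\ge0}$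 be real numbers with $x_t\to\infty$ as $t\to\infty$ such that, for some $K>0$, $\mathbb P[X_1>x_t]\le K(1-z_t)$ for all sufficiently large $t$. Then $$\lim_{t\to\infty}\ \sup_{x\ge x_t}\left|\frac{\mathbb P[S_{N(t)}>x]}{C(\gamma,\beta)\,\mathbb P[\bar F(x)N(t)>1]}-1\right|=0,\qquad C(\gamma,\beta)=\frac{\Gamma(1-\gamma)\,[\Gamma(1-\beta)]^\gamma}{\Gamma(1-\gamma\beta)} .$$ -/

import Mathlib

open MeasureTheory ProbabilityTheory Filter Topology
open scoped NNReal ENNReal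

noncomputable section

/-- The tail function `x ↦ P[Y > x]` of a real random variable `Y`. -/
def tailFun {Ω : Type*} [MeasurableSpace Ω] (μ : Measure Ω) (Y : Ω → ℝ) (x : ℝ) : ℝ :=
  μ.real {ω | x < Y ω}

/-- `G` is regularly varying at infinity with index `-ρ`. (As the limits are positive, such a
`G` is nonzero near infinity, so the value of a division by zero plays no role.) -/
def RegularlyVarying (G : ℝ → ℝ) (ρ : ℝ) : Prop :=
  ∀ Λ : ℝ, 0 < Λ → Tendsto (fun x => G (Λ * x) / G x) atTop (𝓝 (Λ ^ (-ρ)))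

/-- The probability generating function `z ↦ ∑ₙ P[M = n] zⁿ` of an `ℕ`-valued random variable. -/
def genFun {Ω : Type*} [MeasurableSpace Ω] (μ : Measure Ω) (M : Ω → ℕ) (z : ℝ) : ℝ :=
  ∑' n : ℕ, μ.real {ω | M ω = n} * z ^ n

/-- The random sum of the first `M` terms of the sequence `X 0, X 1, …`
(zero where `M = 0`). -/
def randomSum {Ω : Type*} (X : ℕ → Ω → ℝ) (M : Ω → ℕ) (ω : Ω) : ℝ :=
  ∑ k ∈ Finset.range (M ω), X k ω

/-- The constant `C(γ, β) = Γ(1 - γ) Γ(1 - β) ^ γ / Γ(1 - γ β)`. -/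
def stoppedConst (γ β : ℝ) : ℝ :=
  Real.Gamma (1 - γ) * Real.Gamma (1 - β) ^ γ / Real.Gamma (1 - γ * β)

end

/-! Write F for the tail of X and normalise by C_t F(y)^γ. The transform of F(y) N(t) at s is φ
evaluated at exp(-s F(y)), and 1 - exp(-s F(y)) ~ s F(y). The transform of S/y is φ evaluated at the
transform of X at s/y, and one minus that is ~ Γ(1-β) s^β F(y) (`tendsto_one_sub_mgf_div_tailFun`,
by dominated convergence with a Potter bound). Both arguments of φ are thus at distance of order
F(y) ≤ K(1 - z_t) from 1, where the error in the expansion is uniformly negligible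
(`tendsto_one_sub_genFun_div`). The normalised limits are s^γ and Γ(1-β)^γ s^(γβ).

The Tauberian theorem `tendsto_tailFun_of_tendsto_mgf` turns a limit c s^α into the limit c / Γ(1-α)
for the tail at 1. It follows Karamata's method: in the variable exp(-u), Laplace transforms at
integers are moments, Weierstrass approximation passes to continuous test functions, and
monotonicity of tails gives pointwise limits. The quotient of the two tail limits is C(γ, β). -/

/-! ### Tails and Laplace transforms -/

lemma tailFun_nonneg {Ω : Type*} [MeasurableSpace Ω] (μ : Measure Ω) (Y : Ω → ℝ) (x : ℝ) :
    0 ≤ tailFun μ Y x := measureReal_nonneg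

lemma tailFun_le_one {Ω : Type*} [MeasurableSpace Ω] (μ : Measure Ω) [IsProbabilityMeasure μ]
    (Y : Ω → ℝ) (x : ℝ) : tailFun μ Y x ≤ 1 := measureReal_le_one

lemma tailFun_antitone {Ω : Type*} [MeasurableSpace Ω] (μ : Measure Ω) [IsFiniteMeasure μ]
    (Y : Ω → ℝ) : Antitone (tailFun μ Y) := fun _ _ h =>
  measureReal_mono (fun _ hω => lt_of_le_of_lt h hω)

/-- The Laplace transform of a nonnegative random variable in terms of its tail. -/
lemma integral_exp_mul_tailFun {Ω : Type*} [MeasurableSpace Ω] (μ : Measure Ω)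
    [IsProbabilityMeasure μ] {V : Ω → ℝ} (hVm : Measurable V) (hV0 : ∀ᵐ ω ∂μ, 0 ≤ V ω)
    {s : ℝ} (hs : 0 < s) :
    ∫ u in Set.Ioi 0, s * Real.exp (-s * u) * tailFun μ V u = 1 - mgf V μ (-s) := by
  have hle : ∀ᵐ ω ∂μ, Real.exp (-s * V ω) ≤ 1 := by
    filter_upwards [hV0] with ω hω
    rw [Real.exp_le_one_iff]
    nlinarith
  have hint : Integrable (fun ω => Real.exp (-s * V ω)) μ := by
    refine Integrable.of_bound (C := 1) (by fun_prop) ?_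
    filter_upwards [hle] with ω hω
    rwa [Real.norm_of_nonneg (Real.exp_pos _).le]
  have hprim : ∀ v : ℝ, ∫ u in (0:ℝ)..v, s * Real.exp (-s * u) = 1 - Real.exp (-s * v) := by
    intro v
    have hd : ∀ u ∈ Set.uIcc 0 v,
        HasDerivAt (fun u => -Real.exp (-s * u)) (s * Real.exp (-s * u)) u := by
      intro u _
      refine (((hasDerivAt_id u).const_mul (-s)).exp).neg.congr_deriv ?_
      simp only [id]
      ring
    rw [intervalIntegral.integral_eq_sub_of_hasDerivAt hd
      (Continuous.intervalIntegrable (by fun_prop) _ _)]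
    simp
    ring
  -- Layer-cake formula for 1 - exp(-s V), the primitive of `g` evaluated at V.
  have hkey := lintegral_comp_eq_lintegral_meas_lt_mul μ hV0 hVm.aemeasurable
    (g := fun u => s * Real.exp (-s * u))
    (fun t _ => Continuous.intervalIntegrable (by fun_prop) _ _)
    (Eventually.of_forall fun t => by positivity)
  simp only [hprim] at hkey
  have h1 : 1 - mgf V μ (-s) = ∫ ω, (1 - Real.exp (-s * V ω)) ∂μ := by
    rw [integral_sub (integrable_const _) hint]
    simp [mgf]
  rw [h1, integral_eq_lintegral_of_nonneg_ae (μ := μ), hkey, integral_eq_lintegral_of_nonneg_ae]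
  · congr 1
    refine lintegral_congr fun u => ?_
    rw [mul_comm, ENNReal.ofReal_mul' (by positivity), tailFun, ofReal_measureReal]
  · exact Eventually.of_forall fun u => mul_nonneg (by positivity) (tailFun_nonneg _ _ _)
  · have := (tailFun_antitone μ V).measurable
    fun_prop
  · filter_upwards [hle] with ω hω
    simpa using hω
  · fun_prop

/-! ### Karamata's Tauberian theorem -/

/-- Convergence of the Laplace transforms at positive integers gives convergence of the integrals
against continuous functions of `exp (-u)`. -/
lemma tendsto_integral_exp_comp {ι : Type*} {l : Filter ι} {G : ι → ℝ → ℝ} {H : ℝ → ℝ}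
    (hG0 : ∀ i, ∀ u > 0, 0 ≤ G i u) (hH0 : ∀ u > 0, 0 ≤ H u)
    (hGi : ∀ i, IntegrableOn (fun u => Real.exp (-u) * G i u) (Set.Ioi 0))
    (hHi : IntegrableOn (fun u => Real.exp (-u) * H u) (Set.Ioi 0))
    (hmom : ∀ n : ℕ, Tendsto
      (fun i => ∫ u in Set.Ioi 0, Real.exp (-u) ^ n * (Real.exp (-u) * G i u)) l
      (𝓝 (∫ u in Set.Ioi 0, Real.exp (-u) ^ n * (Real.exp (-u) * H u))))
    {f : ℝ → ℝ} (hf : Continuous f) :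
    Tendsto (fun i => ∫ u in Set.Ioi 0, f (Real.exp (-u)) * (Real.exp (-u) * G i u)) l
      (𝓝 (∫ u in Set.Ioi 0, f (Real.exp (-u)) * (Real.exp (-u) * H u))) := by
  have hmem : ∀ u ∈ Set.Ioi (0:ℝ), Real.exp (-u) ∈ Set.Icc (0:ℝ) 1 := fun u hu =>
    ⟨(Real.exp_pos _).le, Real.exp_le_one_iff.2 (by simpa using (Set.mem_Ioi.1 hu).le)⟩
  have hInt : ∀ (K : ℝ → ℝ), IntegrableOn (fun u => Real.exp (-u) * K u) (Set.Ioi 0) →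
      ∀ g : ℝ → ℝ, Continuous g →
      IntegrableOn (fun u => g (Real.exp (-u)) * (Real.exp (-u) * K u)) (Set.Ioi 0) := by
    intro K hK g hg
    obtain ⟨B, hB⟩ := isCompact_Icc.exists_bound_of_continuousOn
      (s := Set.Icc (0:ℝ) 1) hg.continuousOn
    refine Integrable.bdd_mul (c := B) hK (by fun_prop) ?_
    filter_upwards [ae_restrict_mem measurableSet_Ioi] with u hu using hB _ (hmem u hu)
  have hpoly : ∀ p : Polynomial ℝ, Tendsto
      (fun i => ∫ u in Set.Ioi 0, p.eval (Real.exp (-u)) * (Real.exp (-u) * G i u)) l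
      (𝓝 (∫ u in Set.Ioi 0, p.eval (Real.exp (-u)) * (Real.exp (-u) * H u))) := by
    intro p
    induction p using Polynomial.induction_on' with
    | add p q hp hq =>
      simp only [Polynomial.eval_add, add_mul]
      rw [integral_add (hInt H hHi _ p.continuous) (hInt H hHi _ q.continuous)]
      refine (hp.add hq).congr fun i => ?_
      rw [integral_add (hInt _ (hGi i) _ p.continuous) (hInt _ (hGi i) _ q.continuous)]
    | monomial n a =>
      simp only [Polynomial.eval_monomial, mul_assoc, integral_const_mul]
      exact (hmom n).const_mul a
  have hclose : ∀ (K : ℝ → ℝ), (∀ u > 0, 0 ≤ K u) →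
      IntegrableOn (fun u => Real.exp (-u) * K u) (Set.Ioi 0) → ∀ (p : Polynomial ℝ) (δ : ℝ),
      (∀ v ∈ Set.Icc (0:ℝ) 1, |p.eval v - f v| < δ) →
      |(∫ u in Set.Ioi 0, f (Real.exp (-u)) * (Real.exp (-u) * K u)) -
        ∫ u in Set.Ioi 0, p.eval (Real.exp (-u)) * (Real.exp (-u) * K u)| ≤
        δ * ∫ u in Set.Ioi 0, Real.exp (-u) * K u := by
    intro K hK0 hK p δ hp
    rw [← integral_sub (hInt K hK f hf) (hInt K hK _ p.continuous), ← integral_const_mul,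
      ← Real.norm_eq_abs]
    refine norm_integral_le_of_norm_le (hK.const_mul δ) ?_
    filter_upwards [ae_restrict_mem measurableSet_Ioi] with u hu
    have h0 : 0 ≤ Real.exp (-u) * K u := mul_nonneg (Real.exp_pos _).le (hK0 u hu)
    rw [← sub_mul, norm_mul, Real.norm_of_nonneg h0, Real.norm_eq_abs, abs_sub_comm]
    exact mul_le_mul_of_nonneg_right (hp _ (hmem u hu)).le h0
  set M := ∫ u in Set.Ioi 0, Real.exp (-u) * H u with hM
  have hM0 : 0 ≤ M := setIntegral_nonneg measurableSet_Ioi fun u hu =>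
    mul_nonneg (Real.exp_pos _).le (hH0 u hu)
  -- The zeroth moment is the total mass; its eventual bound makes the polynomial approximation
  -- error uniform in `i`.
  have hmass : ∀ᶠ i in l, ∫ u in Set.Ioi 0, Real.exp (-u) * G i u < M + 1 := by
    have := hmom 0
    simp only [pow_zero, one_mul] at this
    exact this.eventually_lt_const (lt_add_one M)
  rw [Metric.tendsto_nhds]
  intro ε hε
  -- Error budget: ε/4 for replacing f by p on each of the two sides, ε/2 for the polynomial limit.
  have hδ : 0 < ε / (4 * (M + 1)) := by positivity
  obtain ⟨p, hp⟩ := exists_polynomial_near_of_continuousOn 0 1 f hf.continuousOn _ hδ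
  filter_upwards [hmass, Metric.tendsto_nhds.1 (hpoly p) (ε / 2) (by positivity)] with i h1 h2
  have hcG := hclose (G i) (hG0 i) (hGi i) p _ hp
  have hcH := hclose H hH0 hHi p _ hp
  have e1 : ε / (4 * (M + 1)) * ∫ u in Set.Ioi 0, Real.exp (-u) * G i u < ε / 4 := by
    calc _ < ε / (4 * (M + 1)) * (M + 1) := mul_lt_mul_of_pos_left h1 hδ
      _ = ε / 4 := by field_simp
  have e2 : ε / (4 * (M + 1)) * ∫ u in Set.Ioi 0, Real.exp (-u) * H u ≤ ε / 4 := by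
    calc _ ≤ ε / (4 * (M + 1)) * (M + 1) := mul_le_mul_of_nonneg_left (by linarith) hδ.le
      _ = ε / 4 := by field_simp
  rw [Real.dist_eq] at h2 ⊢
  rw [abs_lt] at h2 ⊢
  rw [abs_le] at hcG hcH
  constructor <;> linarith [hcG.1, hcG.2, hcH.1, hcH.2, h2.1, h2.2]

/-- Averages over `[a, b]` of antitone functions against a bump in the variable `exp (-u)`. -/
lemma exists_bump_integral {a b : ℝ} (ha : 0 < a) (hab : a < b) :
    ∃ f : ℝ → ℝ, Continuous f ∧ ∃ I > 0, ∀ K : ℝ → ℝ, AntitoneOn K (Set.Ioi 0) →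
      IntegrableOn (fun u => Real.exp (-u) * K u) (Set.Ioi 0) →
      K b * I ≤ ∫ u in Set.Ioi 0, f (Real.exp (-u)) * (Real.exp (-u) * K u) ∧
      ∫ u in Set.Ioi 0, f (Real.exp (-u)) * (Real.exp (-u) * K u) ≤ K a * I := by
  -- The quadratic is positive exactly between exp(-b) and exp(-a), that is, for u in (a, b).
  set f : ℝ → ℝ := fun v => max 0 ((v - Real.exp (-b)) * (Real.exp (-a) - v)) with hfdef
  have hf : Continuous f := by fun_prop
  have hf0 : ∀ v, 0 ≤ f v := fun v => le_max_left _ _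
  have hsupp : ∀ u, u ∉ Set.Icc a b → f (Real.exp (-u)) = 0 := by
    intro u hu
    refine max_eq_left ?_
    rcases lt_or_ge u a with h | h
    · have h1 : Real.exp (-a) < Real.exp (-u) := Real.exp_lt_exp.2 (by linarith)
      have h2 : Real.exp (-b) < Real.exp (-u) := Real.exp_lt_exp.2 (by linarith)
      nlinarith
    · have hb : b < u := by
        by_contra hc
        exact hu ⟨h, not_lt.1 hc⟩
      have h1 : Real.exp (-u) < Real.exp (-a) := Real.exp_lt_exp.2 (by linarith)
      have h2 : Real.exp (-u) < Real.exp (-b) := Real.exp_lt_exp.2 (by linarith)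
      nlinarith
  set w : ℝ → ℝ := fun u => f (Real.exp (-u)) * Real.exp (-u) with hw
  have hwc : Continuous w := by fun_prop
  have hw0 : ∀ u, 0 ≤ w u := fun u => mul_nonneg (hf0 _) (Real.exp_pos _).le
  have hws : ∀ u, u ∉ Set.Icc a b → w u = 0 := fun u hu => by simp [hw, hsupp u hu]
  have hwcs : HasCompactSupport w := HasCompactSupport.intro isCompact_Icc hws
  have hwi : Integrable w := hwc.integrable_of_hasCompactSupport hwcs
  refine ⟨f, hf, ∫ u in Set.Ioi 0, w u, ?_, ?_⟩
  · have hpos : 0 < ∫ u, w u := by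
      refine hwc.integral_pos_of_hasCompactSupport_nonneg_nonzero hwcs hw0 (x := (a + b) / 2) ?_
      have h1 : Real.exp (-((a + b) / 2)) < Real.exp (-a) := Real.exp_lt_exp.2 (by linarith)
      have h2 : Real.exp (-b) < Real.exp (-((a + b) / 2)) := Real.exp_lt_exp.2 (by linarith)
      have h3 : 0 < f (Real.exp (-((a + b) / 2))) :=
        lt_max_of_lt_right (mul_pos (by linarith) (by linarith))
      exact (mul_pos h3 (Real.exp_pos _)).ne'
    rwa [setIntegral_eq_integral_of_forall_compl_eq_zero]
    intro u hu
    exact hws u fun h => hu (lt_of_lt_of_le ha h.1)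
  · intro K hK hKi
    have hprod : IntegrableOn (fun u => f (Real.exp (-u)) * (Real.exp (-u) * K u))
        (Set.Ioi 0) := by
      refine Integrable.bdd_mul (c := 1) hKi (by fun_prop) ?_
      filter_upwards [ae_restrict_mem measurableSet_Ioi] with u hu
      have h1 : Real.exp (-u) ≤ 1 := Real.exp_le_one_iff.2 (by simpa using (Set.mem_Ioi.1 hu).le)
      have h2 : Real.exp (-a) ≤ 1 := Real.exp_le_one_iff.2 (by linarith)
      rw [Real.norm_of_nonneg (hf0 _)]
      refine max_le zero_le_one ?_
      have h3 := Real.exp_pos (-u)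
      have h4 := Real.exp_pos (-a)
      have h5 := Real.exp_pos (-b)
      rcases lt_or_ge (Real.exp (-u)) (Real.exp (-b)) with h | h
      · have : Real.exp (-b) < Real.exp (-a) := Real.exp_lt_exp.2 (by linarith)
        nlinarith
      · nlinarith
    rw [← integral_const_mul, ← integral_const_mul]
    constructor
    · refine setIntegral_mono_on (hwi.integrableOn.const_mul _) hprod measurableSet_Ioi ?_
      intro u hu
      by_cases h : u ∈ Set.Icc a b
      · have := mul_le_mul_of_nonneg_right
          (hK hu (Set.mem_Ioi.2 (ha.trans hab)) h.2) (hw0 u)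
        calc _ ≤ _ := this
          _ = _ := by simp only [hw]; ring
      · rw [hws u h, hsupp u h]; simp
    · refine setIntegral_mono_on hprod (hwi.integrableOn.const_mul _) measurableSet_Ioi ?_
      intro u hu
      by_cases h : u ∈ Set.Icc a b
      · have := mul_le_mul_of_nonneg_right (hK (Set.mem_Ioi.2 ha) hu h.1) (hw0 u)
        calc _ = _ := by simp only [hw]; ring
          _ ≤ _ := this
      · rw [hws u h, hsupp u h]; simp

/-- A continuity theorem for Laplace transforms of monotone densities. -/
lemma tendsto_of_tendsto_laplace_antitone {ι : Type*} {l : Filter ι} {G : ι → ℝ → ℝ}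
    {H : ℝ → ℝ} {x : ℝ} (hx : 0 < x)
    (hG0 : ∀ i, ∀ u > 0, 0 ≤ G i u) (hH0 : ∀ u > 0, 0 ≤ H u)
    (hGa : ∀ i, AntitoneOn (G i) (Set.Ioi 0)) (hHa : AntitoneOn H (Set.Ioi 0))
    (hGi : ∀ i, IntegrableOn (fun u => Real.exp (-u) * G i u) (Set.Ioi 0))
    (hHi : IntegrableOn (fun u => Real.exp (-u) * H u) (Set.Ioi 0))
    (hmom : ∀ n : ℕ, Tendsto
      (fun i => ∫ u in Set.Ioi 0, Real.exp (-u) ^ n * (Real.exp (-u) * G i u)) l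
      (𝓝 (∫ u in Set.Ioi 0, Real.exp (-u) ^ n * (Real.exp (-u) * H u))))
    (hHc : ContinuousAt H x) : Tendsto (fun i => G i x) l (𝓝 (H x)) := by
  rw [tendsto_order]
  constructor
  · intro c hc
    -- Weighted averages over [x, b] separate the values: that of `H` is at least `H b` > c, that of
    -- `G i` at most `G i x`. The upper bound uses [a, x] symmetrically.
    have hev : ∀ᶠ b in 𝓝[>] x, c < H b :=
      (hHc.tendsto.mono_left nhdsWithin_le_nhds).eventually_const_lt hc
    obtain ⟨b, hcb, hxb⟩ := (hev.and self_mem_nhdsWithin).exists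
    obtain ⟨f, hf, I, hI, hfI⟩ := exists_bump_integral hx hxb
    have hlim := tendsto_integral_exp_comp hG0 hH0 hGi hHi hmom hf
    have h1 : c * I < ∫ u in Set.Ioi 0, f (Real.exp (-u)) * (Real.exp (-u) * H u) :=
      (mul_lt_mul_of_pos_right hcb hI).trans_le (hfI H hHa hHi).1
    filter_upwards [hlim.eventually_const_lt h1] with i hi
    exact lt_of_mul_lt_mul_right (hi.trans_le (hfI (G i) (hGa i) (hGi i)).2) hI.le
  · intro c hc
    have hev : ∀ᶠ a in 𝓝[<] x, H a < c :=
      (hHc.tendsto.mono_left nhdsWithin_le_nhds).eventually_lt_const hc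
    obtain ⟨a, hca, ha, hxa⟩ := (hev.and (Ioo_mem_nhdsLT hx)).exists
    obtain ⟨f, hf, I, hI, hfI⟩ := exists_bump_integral ha hxa
    have hlim := tendsto_integral_exp_comp hG0 hH0 hGi hHi hmom hf
    have h1 : ∫ u in Set.Ioi 0, f (Real.exp (-u)) * (Real.exp (-u) * H u) < c * I :=
      (hfI H hHa hHi).2.trans_lt (mul_lt_mul_of_pos_right hca hI)
    filter_upwards [hlim.eventually_lt_const h1] with i hi
    exact lt_of_mul_lt_mul_right ((hfI (G i) (hGa i) (hGi i)).1.trans_lt hi) hI.le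

/-- A Tauberian theorem: if the rescaled Laplace transforms of nonnegative random variables
behave like `c * s ^ α`, then the rescaled tails at `1` converge to `c / Γ (1 - α)`. -/
lemma tendsto_tailFun_of_tendsto_mgf {Ω ι : Type*} [MeasurableSpace Ω] (μ : Measure Ω)
    [IsProbabilityMeasure μ] {l : Filter ι} {V : ι → Ω → ℝ} (hVm : ∀ i, Measurable (V i))
    (hV0 : ∀ i, ∀ᵐ ω ∂μ, 0 ≤ V i ω) {a : ι → ℝ} (ha : ∀ i, 0 ≤ a i) {α c : ℝ} (hα0 : 0 < α)
    (hα1 : α < 1) (hc : 0 ≤ c)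
    (hlim : ∀ s > 0, Tendsto (fun i => (1 - mgf (V i) μ (-s)) / a i) l (𝓝 (c * s ^ α))) :
    Tendsto (fun i => tailFun μ (V i) 1 / a i) l (𝓝 (c / Real.Gamma (1 - α))) := by
  have hΓ : 0 < Real.Gamma (1 - α) := Real.Gamma_pos_of_pos (by linarith)
  have hpow : ∀ (n : ℕ) (u : ℝ),
      Real.exp (-u) ^ n * Real.exp (-u) = Real.exp (-((n + 1 : ℝ) * u)) := by
    intro n u
    rw [← pow_succ, ← Real.exp_nat_mul]
    push_cast
    ring_nf
  have hint : IntegrableOn (fun u => Real.exp (-u)) (Set.Ioi 0) := by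
    simpa using integrableOn_exp_mul_Ioi (a := -1) (by norm_num) 0
  have key := tendsto_of_tendsto_laplace_antitone (l := l) (x := 1) one_pos
    (G := fun i u => tailFun μ (V i) u / a i)
    (H := fun u => c / Real.Gamma (1 - α) * u ^ (-α))
    (fun i u _ => div_nonneg (tailFun_nonneg _ _ _) (ha i))
    (fun u hu => by have : 0 < u := hu; positivity)
    (fun i u _ v _ huv => div_le_div_of_nonneg_right (tailFun_antitone μ (V i) huv) (ha i))
    (fun u hu v _ huv => mul_le_mul_of_nonneg_left
      (Real.rpow_le_rpow_of_nonpos hu huv (by linarith)) (by positivity))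
    (fun i => by
      have hm := (tailFun_antitone μ (V i)).measurable
      refine Integrable.mul_bdd (c := 1 / a i) hint (by fun_prop)
        (Eventually.of_forall fun u => ?_)
      rw [Real.norm_of_nonneg (div_nonneg (tailFun_nonneg _ _ _) (ha i))]
      exact div_le_div_of_nonneg_right (tailFun_le_one _ _ _) (ha i))
    (by
      have h := (Real.GammaIntegral_convergent (s := 1 - α) (by linarith)).const_mul
        (c / Real.Gamma (1 - α))
      refine h.congr (Eventually.of_forall fun u => ?_)
      simp only [show 1 - α - 1 = -α by ring]
      ring)
    -- The n-th moment of the tail is its Laplace integral at n + 1, hence one minus the mgf at -(n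
    -- + 1), divided by n + 1.
    (fun n => by
      have hs : (0:ℝ) < n + 1 := by positivity
      have hR : ∫ u in Set.Ioi 0, Real.exp (-u) ^ n *
          (Real.exp (-u) * (c / Real.Gamma (1 - α) * u ^ (-α))) =
          (c * (n + 1 : ℝ) ^ α) / (n + 1) := by
        have h := Real.integral_rpow_mul_exp_neg_mul_Ioi (a := 1 - α) (by linarith) hs
        calc _ = ∫ u in Set.Ioi 0, c / Real.Gamma (1 - α) *
              (u ^ (1 - α - 1) * Real.exp (-((n + 1 : ℝ) * u))) := by
              refine integral_congr_ae (Eventually.of_forall fun u => ?_)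
              simp only [show 1 - α - 1 = -α by ring, ← hpow]
              ring
          _ = _ := by
              rw [integral_const_mul, h, one_div, Real.inv_rpow hs.le, Real.rpow_sub hs,
                Real.rpow_one]
              field_simp
      rw [hR]
      refine ((hlim _ hs).div_const (n + 1 : ℝ)).congr fun i => ?_
      rw [← integral_exp_mul_tailFun μ (hVm i) (hV0 i) hs, ← integral_div, ← integral_div]
      refine integral_congr_ae (Eventually.of_forall fun u => ?_)
      simp only [← mul_assoc, hpow]
      rw [neg_mul]
      field_simp)
    (by
      refine ContinuousAt.mul continuousAt_const ?_
      exact Real.continuousAt_rpow_const _ _ (Or.inl one_ne_zero))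
  simpa using key

/-! ### Regular variation and the Abelian theorem -/

/-- A zero of `G` would persist to its right, where 0 / 0 = 0 makes the quotient with Λ = 1 vanish
instead of tending to 1. -/
lemma RegularlyVarying.pos {G : ℝ → ℝ} {ρ : ℝ} (hG : RegularlyVarying G ρ) (hanti : Antitone G)
    (h0 : ∀ x, 0 ≤ G x) (x : ℝ) : 0 < G x := by
  by_contra hx
  have hzero : ∀ᶠ y in atTop, G (1 * y) / G y = 0 := by
    filter_upwards [eventually_ge_atTop x] with y hy
    rw [le_antisymm ((hanti hy).trans (not_lt.1 hx)) (h0 y), div_zero]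
  have h := hG 1 one_pos
  rw [Real.one_rpow] at h
  exact zero_ne_one (tendsto_nhds_unique (tendsto_const_nhds.congr'
    (hzero.mono fun _ h => h.symm)) h)

/-- A Potter bound for antitone regularly varying functions. -/
lemma RegularlyVarying.exists_potter_bound {G : ℝ → ℝ} {ρ δ : ℝ} (hG : RegularlyVarying G ρ)
    (hanti : Antitone G) (h0 : ∀ x, 0 ≤ G x) (h1 : ∀ x, G x ≤ 1) (hδ0 : 0 < δ) (hδ : ρ < δ) :
    ∃ A > 0, ∃ x₀ > 0, ∀ y ≥ x₀, ∀ u, 0 < u → u ≤ 1 → G (u * y) ≤ A * u ^ (-δ) * G y := by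
  have hpos := hG.pos hanti h0
  have hlt : (2:ℝ) ^ (-δ) < 2 ^ (-ρ) :=
    Real.rpow_lt_rpow_of_exponent_lt one_lt_two (by linarith)
  obtain ⟨x₁, hx₁⟩ := eventually_atTop.1 ((hG 2 two_pos).eventually_const_lt hlt)
  set x₀ := max x₁ 1 with hx₀
  have hx₀pos : 0 < x₀ := lt_of_lt_of_le one_pos (le_max_right _ _)
  have hstep : ∀ x ≥ x₀, G x ≤ 2 ^ δ * G (2 * x) := by
    intro x hx
    have h := hx₁ x ((le_max_left _ _).trans hx)
    rw [lt_div_iff₀ (hpos x), Real.rpow_neg two_pos.le, inv_mul_lt_iff₀ (by positivity)] at h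
    exact h.le
  have hiter : ∀ (n : ℕ), ∀ x ≥ x₀, G x ≤ (2 ^ δ) ^ n * G (2 ^ n * x) := by
    intro n
    induction n with
    | zero => intro x _; simp
    | succ n ih =>
      intro x hx
      calc G x ≤ 2 ^ δ * G (2 * x) := hstep x hx
        _ ≤ 2 ^ δ * ((2 ^ δ) ^ n * G (2 ^ n * (2 * x))) :=
          mul_le_mul_of_nonneg_left (ih (2 * x) (by linarith)) (by positivity)
        _ = _ := by rw [pow_succ, pow_succ, mul_assoc (2 ^ n : ℝ)]; ring
  -- Iterate the doubling bound n + 1 times, where 2^n ≤ y/x < 2^(n+1); the extra doubling costs the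
  -- factor 2^δ.
  have hpotter : ∀ x ≥ x₀, ∀ y ≥ x, G x ≤ 2 ^ δ * (y / x) ^ δ * G y := by
    intro x hx y hy
    have hxpos : 0 < x := hx₀pos.trans_le hx
    obtain ⟨n, hn1, hn2⟩ := exists_nat_pow_near ((one_le_div hxpos).2 hy) one_lt_two
    calc G x ≤ (2 ^ δ) ^ (n + 1) * G (2 ^ (n + 1) * x) := hiter _ x hx
      _ ≤ (2 ^ δ) ^ (n + 1) * G y :=
        mul_le_mul_of_nonneg_left (hanti ((div_lt_iff₀ hxpos).1 hn2).le) (by positivity)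
      _ = 2 ^ δ * ((2:ℝ) ^ n) ^ δ * G y := by
        rw [pow_succ, ← Real.rpow_natCast, ← Real.rpow_mul two_pos.le, mul_comm δ,
          Real.rpow_mul two_pos.le, Real.rpow_natCast]
        ring
      _ ≤ _ := mul_le_mul_of_nonneg_right (mul_le_mul_of_nonneg_left
          (Real.rpow_le_rpow (by positivity) hn1 hδ0.le) (by positivity)) (h0 y)
  -- Dividing by `G x₀` covers the case u y < x₀, where `G (u * y)` is only bounded by 1 = `G x₀ / G
  -- x₀`.
  refine ⟨2 ^ δ / G x₀, div_pos (by positivity) (hpos _), x₀, hx₀pos, ?_⟩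
  intro y hy u hu hu1
  have hypos : 0 < y := hx₀pos.trans_le hy
  have hA : (2:ℝ) ^ δ ≤ 2 ^ δ / G x₀ := le_div_self (by positivity) (hpos _) (h1 _)
  have hinv : u ^ (-δ) = (1 / u) ^ δ := by
    rw [one_div, Real.inv_rpow hu.le, Real.rpow_neg hu.le]
  rcases le_or_gt x₀ (u * y) with h | h
  · have hle := hpotter (u * y) h y (by nlinarith)
    rw [show y / (u * y) = 1 / u by field_simp, ← hinv] at hle
    refine hle.trans (mul_le_mul_of_nonneg_right (mul_le_mul_of_nonneg_right hA ?_) (h0 y))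
    positivity
  · calc G (u * y) ≤ 1 := h1 _
      _ = G x₀ / G x₀ := (div_self (hpos _).ne').symm
      _ ≤ (2 ^ δ * (y / x₀) ^ δ * G y) / G x₀ :=
        div_le_div_of_nonneg_right (hpotter x₀ le_rfl y hy) (h0 _)
      _ ≤ (2 ^ δ * (1 / u) ^ δ * G y) / G x₀ := by
        refine div_le_div_of_nonneg_right (mul_le_mul_of_nonneg_right
          (mul_le_mul_of_nonneg_left (Real.rpow_le_rpow (by positivity) ?_ hδ0.le)
          (by positivity)) (h0 y)) (h0 _)
        rw [div_le_div_iff₀ hx₀pos hu]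
        linarith
      _ = _ := by rw [hinv]; ring

/-- The Abelian theorem for the Laplace transform of a law with regularly varying tail. -/
lemma tendsto_one_sub_mgf_div_tailFun {Ω : Type*} [MeasurableSpace Ω] (μ : Measure Ω)
    [IsProbabilityMeasure μ] {Y : Ω → ℝ} (hYm : Measurable Y) (hY0 : ∀ᵐ ω ∂μ, 0 ≤ Y ω)
    {β : ℝ} (hβ0 : 0 < β) (hβ1 : β < 1) (hY : RegularlyVarying (tailFun μ Y) β)
    {s : ℝ} (hs : 0 < s) :
    Tendsto (fun y => (1 - mgf Y μ (-(s / y))) / tailFun μ Y y) atTop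
      (𝓝 (Real.Gamma (1 - β) * s ^ β)) := by
  have hanti := tailFun_antitone μ Y
  have hpos := hY.pos hanti (tailFun_nonneg μ Y)
  -- Strictly between β and 1: the Potter bound needs β < δ, integrability of u^(-δ) at 0 needs δ <
  -- 1.
  set δ := (1 + β) / 2 with hδ
  obtain ⟨A, hA, x₀, hx₀, hbound⟩ := hY.exists_potter_bound hanti (tailFun_nonneg μ Y)
    (tailFun_le_one μ Y) (δ := δ) (by linarith) (by linarith)
  have hform : ∀ y > 0, (1 - mgf Y μ (-(s / y))) / tailFun μ Y y =
      ∫ u in Set.Ioi 0, s * Real.exp (-s * u) * (tailFun μ Y (u * y) / tailFun μ Y y) := by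
    intro y hy
    have h := integral_exp_mul_tailFun μ (hYm.const_mul y⁻¹)
      (hY0.mono fun ω hω => mul_nonneg (inv_nonneg.2 hy.le) hω) hs
    rw [mgf_const_mul] at h
    rw [show -(s / y) = y⁻¹ * -s by field_simp, ← h, ← integral_div]
    refine integral_congr_ae (Eventually.of_forall fun u => ?_)
    have : tailFun μ (fun ω => y⁻¹ * Y ω) u = tailFun μ Y (u * y) := by
      unfold tailFun
      congr 1
      ext ω
      simp only [Set.mem_ofPred_eq]
      rw [inv_mul_eq_div, lt_div_iff₀ hy]
    simp only [this]
    ring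
  have hval : ∫ u in Set.Ioi 0, s * Real.exp (-s * u) * u ^ (-β) =
      Real.Gamma (1 - β) * s ^ β := by
    have h := Real.integral_rpow_mul_exp_neg_mul_Ioi (a := 1 - β) (by linarith) hs
    calc _ = ∫ u in Set.Ioi 0, s * (u ^ (1 - β - 1) * Real.exp (-(s * u))) := by
          refine integral_congr_ae (Eventually.of_forall fun u => ?_)
          simp only [show 1 - β - 1 = -β by ring, neg_mul]
          ring
      _ = _ := by
          rw [integral_const_mul, h, one_div, Real.inv_rpow hs.le, Real.rpow_sub hs,
            Real.rpow_one]
          field_simp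
  rw [← hval]
  have hcongr : (fun y => ∫ u in Set.Ioi 0, s * Real.exp (-s * u) *
      (tailFun μ Y (u * y) / tailFun μ Y y)) =ᶠ[atTop]
      fun y => (1 - mgf Y μ (-(s / y))) / tailFun μ Y y := by
    filter_upwards [eventually_gt_atTop 0] with y hy using (hform y hy).symm
  refine Tendsto.congr' hcongr ?_
  refine tendsto_integral_filter_of_dominated_convergence
    -- The first term dominates for u > 1 by monotonicity of the tail, the second for u ≤ 1 by the
    -- Potter bound.
    (fun u => s * Real.exp (-s * u) * 1 + A * s * (u ^ (-δ) * Real.exp (-s * u ^ (1:ℝ))))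
    ?_ ?_ ?_ ?_
  · refine Eventually.of_forall fun y => ?_
    have := hanti.measurable
    fun_prop
  · filter_upwards [eventually_ge_atTop x₀] with y hy
    filter_upwards [ae_restrict_mem measurableSet_Ioi] with u hu
    have hu : 0 < u := hu
    have hy0 : 0 < y := hx₀.trans_le hy
    have hn := tailFun_nonneg μ Y (u * y)
    have hr : tailFun μ Y (u * y) / tailFun μ Y y ≤ 1 + A * u ^ (-δ) := by
      rw [div_le_iff₀ (hpos y)]
      rcases le_or_gt u 1 with h | h
      · have := hbound y hy u hu h
        nlinarith [hpos y]
      · have h2 : tailFun μ Y (u * y) ≤ tailFun μ Y y := hanti (by nlinarith)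
        have h3 : 0 ≤ A * u ^ (-δ) * tailFun μ Y y :=
          mul_nonneg (by positivity) (hpos y).le
        linarith
    have hpy := hpos y
    rw [Real.norm_of_nonneg (by positivity)]
    calc _ ≤ s * Real.exp (-s * u) * (1 + A * u ^ (-δ)) :=
          mul_le_mul_of_nonneg_left hr (by positivity)
      _ = _ := by rw [Real.rpow_one]; ring
  · refine Integrable.add ?_ ?_
    · simp only [mul_one]
      exact (integrableOn_exp_mul_Ioi (by linarith) 0).const_mul s
    · exact (integrableOn_rpow_mul_exp_neg_mul_rpow (by linarith) one_pos hs).const_mul _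
  · filter_upwards [ae_restrict_mem measurableSet_Ioi] with u hu
    exact (hY u hu).const_mul _

/-! ### Transforms as generating functions -/

/-- Partitioning by the value of `M` reduces both transforms, of the count and of the random sum, to
a computation for fixed n. -/
lemma integral_eq_genFun {Ω : Type*} [MeasurableSpace Ω] {μ : Measure Ω} {M : Ω → ℕ}
    (hM : Measurable M) {Y : Ω → ℝ} (hY : Integrable Y μ) {w : ℝ}
    (h : ∀ n, ∫ ω in {ω | M ω = n}, Y ω ∂μ = μ.real {ω | M ω = n} * w ^ n) :
    ∫ ω, Y ω ∂μ = genFun μ M w := by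
  have hU : (⋃ n, {ω | M ω = n}) = Set.univ := by
    ext ω
    simp
  have hsum := hasSum_integral_iUnion (μ := μ) (f := Y) (s := fun n => {ω | M ω = n})
    (fun n => hM (measurableSet_singleton n))
    (fun i j hij => Set.disjoint_left.2 fun ω (h1 : M ω = i) (h2 : M ω = j) =>
      hij (h1.symm.trans h2)) hY.integrableOn
  rw [hU, setIntegral_univ] at hsum
  rw [← hsum.tsum_eq, genFun]
  exact tsum_congr h

lemma mgf_mul_natCast {Ω : Type*} [MeasurableSpace Ω] (μ : Measure Ω) [IsProbabilityMeasure μ]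
    {M : Ω → ℕ} (hM : Measurable M) {r : ℝ} (hr : 0 ≤ r) {s : ℝ} (hs : 0 ≤ s) :
    mgf (fun ω => r * (M ω : ℝ)) μ (-s) = genFun μ M (Real.exp (-(s * r))) := by
  have hMr : Measurable fun ω => (M ω : ℝ) := measurable_from_nat.comp hM
  refine integral_eq_genFun hM (Integrable.of_bound (C := 1) (by fun_prop)
    (Eventually.of_forall fun ω => ?_)) fun n => ?_
  · rw [Real.norm_of_nonneg (Real.exp_pos _).le, Real.exp_le_one_iff, neg_mul, neg_nonpos]
    positivity
  · have hset : MeasurableSet {ω | M ω = n} := hM (measurableSet_singleton n)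
    rw [setIntegral_congr_fun hset (g := fun _ => Real.exp (-(s * r)) ^ n), setIntegral_const, smul_eq_mul]
    intro ω hω
    have hω : M ω = n := hω
    simp only [hω, ← Real.exp_nat_mul]
    ring_nf

lemma measurable_randomSum {Ω : Type*} [MeasurableSpace Ω] {X : ℕ → Ω → ℝ} {M : Ω → ℕ}
    (hX : ∀ k, Measurable (X k)) (hM : Measurable M) : Measurable (randomSum X M) := by
  have h : Measurable fun p : ℕ × Ω => ∑ k ∈ Finset.range p.1, X k p.2 :=
    measurable_from_prod_countable_right fun n =>
      Finset.measurable_fun_sum (Finset.range n) fun k _ => hX k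
  exact h.comp (hM.prodMk measurable_id)

lemma randomSum_nonneg {Ω : Type*} [MeasurableSpace Ω] {μ : Measure Ω} {X : ℕ → Ω → ℝ}
    (hX0 : ∀ k, ∀ᵐ ω ∂μ, 0 ≤ X k ω) (M : Ω → ℕ) : ∀ᵐ ω ∂μ, 0 ≤ randomSum X M ω := by
  filter_upwards [ae_all_iff.2 hX0] with ω hω
  exact Finset.sum_nonneg fun k _ => hω k

/-- The Laplace transform of a random sum. -/
lemma mgf_randomSum {Ω : Type*} [MeasurableSpace Ω] (μ : Measure Ω) [IsProbabilityMeasure μ]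
    {X : ℕ → Ω → ℝ} {M : Ω → ℕ} (hXm : ∀ k, Measurable (X k))
    (hX0 : ∀ k, ∀ᵐ ω ∂μ, 0 ≤ X k ω) (hXind : iIndepFun X μ)
    (hXid : ∀ k, IdentDistrib (X k) (X 0) μ μ) (hM : Measurable M)
    (hMX : IndepFun M (fun ω k => X k ω) μ) {s : ℝ} (hs : 0 ≤ s) :
    mgf (randomSum X M) μ (-s) = genFun μ M (mgf (X 0) μ (-s)) := by
  have hSm := measurable_randomSum hXm hM
  refine integral_eq_genFun hM (Integrable.of_bound (C := 1) (by fun_prop) ?_) fun n => ?_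
  · filter_upwards [randomSum_nonneg hX0 M] with ω hω
    rw [Real.norm_of_nonneg (Real.exp_pos _).le, Real.exp_le_one_iff, neg_mul, neg_nonpos]
    positivity
  · have hset : MeasurableSet {ω | M ω = n} := hM (measurableSet_singleton n)
    have hsum : mgf (∑ k ∈ Finset.range n, X k) μ (-s) = mgf (X 0) μ (-s) ^ n := by
      rw [hXind.mgf_sum hXm, Finset.prod_congr rfl fun k _ =>
        congrFun (mgf_congr_identDistrib (hXid k)) (-s)]
      simp
    -- On {M = n} the random sum is a fixed function of the sequence, so independence factors its
    -- exponential from the indicator.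
    have hind := hMX.integral_fun_comp_mul_comp hM.aemeasurable
      (measurable_pi_lambda _ hXm).aemeasurable
      (f := Set.indicator {n} fun _ => (1:ℝ))
      (g := fun v => Real.exp (-s * ∑ k ∈ Finset.range n, v k))
      (measurable_const.indicator (measurableSet_singleton n)).aestronglyMeasurable
      (Measurable.aestronglyMeasurable (by fun_prop))
    rw [← hsum, ← integral_indicator hset]
    have h1 : ∫ ω, Set.indicator {n} (fun _ => (1:ℝ)) (M ω) ∂μ = μ.real {ω | M ω = n} := by
      rw [← integral_indicator_one hset]
      rfl
    have h2 : mgf (∑ k ∈ Finset.range n, X k) μ (-s) =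
        ∫ ω, Real.exp (-s * ∑ k ∈ Finset.range n, X k ω) ∂μ := by
      simp [mgf]
    rw [← h1, h2, ← hind]
    congr 1
    ext ω
    by_cases h : M ω = n
    · simp [Set.indicator, h, randomSum]
    · simp [Set.indicator, h]

/-! ### Generating functions near 1 -/

/-- The asymptotics of generating functions near `1` at a scale `q` controlled by `d`. -/
lemma tendsto_one_sub_genFun_div {ι : Type*} {l : Filter ι} {φ : ι → ℝ → ℝ} {e : ι → ℝ → ℝ}
    {C d q u : ι → ℝ} {γ κ K : ℝ} (hC : ∀ i, 0 < C i) (hq : ∀ i, 0 < q i) (hκ : 0 < κ)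
    (hφ : ∀ i, ∀ w : ℝ, 0 ≤ w → w < 1 → φ i w = 1 - C i * (1 - w) ^ γ + e i (1 - w))
    (herr : ∀ r : ℝ, 0 < r → Tendsto
      (fun i => ⨆ w ∈ {w : ℝ | 0 ≤ w ∧ w < 1 ∧ 1 - w ≤ r * d i},
        ENNReal.ofReal |e i (1 - w) / (C i * (1 - w) ^ γ)|) l (𝓝 0))
    (hK : 0 < K) (hqd : ∀ᶠ i in l, q i ≤ K * d i) (hu1 : ∀ i, u i ≤ 1)
    (hu : Tendsto (fun i => u i / q i) l (𝓝 κ)) :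
    Tendsto (fun i => (1 - φ i (1 - u i)) / (C i * q i ^ γ)) l (𝓝 (κ ^ γ)) := by
  have hupos : ∀ᶠ i in l, 0 < u i := by
    filter_upwards [hu.eventually_const_lt hκ] with i hi
    exact (div_pos_iff_of_pos_right (hq i)).1 hi
  -- This places 1 - u in the region of the uniform error bound with r = (κ + 1) K.
  have hule : ∀ᶠ i in l, u i ≤ (κ + 1) * K * d i := by
    filter_upwards [hu.eventually_lt_const (lt_add_one κ), hqd] with i h1 h2
    rw [div_lt_iff₀ (hq i)] at h1
    calc u i ≤ (κ + 1) * q i := h1.le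
      _ ≤ (κ + 1) * (K * d i) := mul_le_mul_of_nonneg_left h2 (by linarith)
      _ = _ := by ring
  have hE : Tendsto (fun i => e i (u i) / (C i * u i ^ γ)) l (𝓝 0) := by
    have hofReal : Tendsto (fun i => ENNReal.ofReal |e i (u i) / (C i * u i ^ γ)|) l (𝓝 0) := by
      refine tendsto_of_tendsto_of_tendsto_of_le_of_le' tendsto_const_nhds
        (herr ((κ + 1) * K) (by positivity)) (Eventually.of_forall fun _ => zero_le) ?_
      filter_upwards [hupos, hule] with i h1 h2
      have hm : 1 - u i ∈ {w : ℝ | 0 ≤ w ∧ w < 1 ∧ 1 - w ≤ (κ + 1) * K * d i} :=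
        ⟨by linarith [hu1 i], by linarith, by linarith⟩
      have := le_iSup₂ (f := fun (w : ℝ)
        (_ : w ∈ {w : ℝ | 0 ≤ w ∧ w < 1 ∧ 1 - w ≤ (κ + 1) * K * d i}) =>
        ENNReal.ofReal |e i (1 - w) / (C i * (1 - w) ^ γ)|) (1 - u i) hm
      simpa using this
    have := (ENNReal.tendsto_toReal ENNReal.zero_ne_top).comp hofReal
    refine (tendsto_zero_iff_abs_tendsto_zero _).2 (this.congr fun i => ?_)
    simp
  have hmain : Tendsto (fun i => (1 - e i (u i) / (C i * u i ^ γ)) * (u i / q i) ^ γ) l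
      (𝓝 ((1 - 0) * κ ^ γ)) :=
    (tendsto_const_nhds.sub hE).mul (hu.rpow_const (Or.inl hκ.ne'))
  rw [sub_zero, one_mul] at hmain
  refine hmain.congr' ?_
  filter_upwards [hupos] with i h1
  have hup : 0 < u i ^ γ := Real.rpow_pos_of_pos h1 _
  have hqp : 0 < q i ^ γ := Real.rpow_pos_of_pos (hq i) _
  have hCi := hC i
  rw [hφ i _ (by linarith [hu1 i]) (by linarith), Real.div_rpow h1.le (hq i).le]
  simp only [sub_sub_cancel]
  field_simp
  ring

lemma tendsto_one_sub_exp_neg_mul_div {ι : Type*} {l : Filter ι} {q : ι → ℝ}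
    (hq0 : ∀ i, 0 < q i) (hq : Tendsto q l (𝓝 0)) (s : ℝ) :
    Tendsto (fun i => (1 - Real.exp (-(s * q i))) / q i) l (𝓝 s) := by
  have hd : HasDerivAt (fun v : ℝ => -Real.exp (-(s * v))) s 0 := by
    refine ((((hasDerivAt_id (0:ℝ)).const_mul s).fun_neg).exp).fun_neg.congr_deriv ?_
    simp
  have h := hd.tendsto_slope_zero
  have hq' : Tendsto q l (𝓝[≠] 0) :=
    tendsto_nhdsWithin_iff.2 ⟨hq, Eventually.of_forall fun i => (hq0 i).ne'⟩
  refine (h.comp hq').congr fun i => ?_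
  simp
  ring

/-! ### The uniform large deviation asymptotics -/

theorem mainTheorem7 {Ω : Type*} [MeasurableSpace Ω] (μ : Measure Ω) [IsProbabilityMeasure μ]
    (β γ : ℝ) (hβ : 0 < β ∧ β < 1) (hγ : 0 < γ ∧ γ < 1)
    -- i.i.d. nonnegative increments with regularly varying tail of index `-β`
    (X : ℕ → Ω → ℝ) (hXm : ∀ k, Measurable (X k)) (hX0 : ∀ k, ∀ᵐ ω ∂μ, 0 ≤ X k ω)
    (hXind : iIndepFun X μ) (hXid : ∀ k, IdentDistrib (X k) (X 0) μ μ)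
    (hXrv : RegularlyVarying (tailFun μ (X 0)) β)
    -- the process `N(t)`, independent of the increments
    (N : ℝ≥0 → Ω → ℕ) (hNm : ∀ t, Measurable (N t))
    (hNX : ∀ t, IndepFun (N t) (fun ω k => X k ω) μ)
    -- the expansion of the generating functions
    (C z : ℝ≥0 → ℝ) (hC : ∀ t, 0 < C t) (hz : ∀ t, 0 < z t) (hz1 : Tendsto z atTop (𝓝 1))
    (err : ℝ≥0 → ℝ → ℝ)
    (hφ : ∀ t, ∀ w : ℝ, 0 ≤ w → w < 1 →
      genFun μ (N t) w = 1 - C t * (1 - w) ^ γ + err t (1 - w))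
    (herr : ∀ l : ℝ, 0 < l → Tendsto
      (fun t => ⨆ w ∈ {w : ℝ | 0 ≤ w ∧ w < 1 ∧ 1 - w ≤ l * (1 - z t)},
        ENNReal.ofReal |err t (1 - w) / (C t * (1 - w) ^ γ)|) atTop (𝓝 0))
    -- the large deviation region
    (x : ℝ≥0 → ℝ) (hx : Tendsto x atTop atTop)
    (hxz : ∃ K : ℝ, 0 < K ∧ ∀ᶠ t in atTop, tailFun μ (X 0) (x t) ≤ K * (1 - z t)) :
    Tendsto
      (fun t => ⨆ y ∈ Set.Ici (x t), ENNReal.ofReal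
        |μ.real {ω | y < randomSum X (N t) ω} /
          (stoppedConst γ β * μ.real {ω | 1 < tailFun μ (X 0) y * (N t ω : ℝ)}) - 1|)
      atTop (𝓝 0) := by
  obtain ⟨hβ0, hβ1⟩ := hβ
  obtain ⟨hγ0, hγ1⟩ := hγ
  obtain ⟨K, hK, hKz⟩ := hxz
  set F := tailFun μ (X 0) with hF
  have hFanti : Antitone F := tailFun_antitone μ (X 0)
  have hFpos : ∀ y, 0 < F y := hXrv.pos hFanti (tailFun_nonneg μ (X 0))
  -- uniformity over `y ≥ x t` is convergence along the following filter on pairs `(t, y)`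
  set L : Filter (ℝ≥0 × ℝ) := comap Prod.fst atTop ⊓ 𝓟 {p | x p.1 ≤ p.2} with hL
  have hT : Tendsto Prod.fst L atTop := tendsto_comap.mono_left inf_le_left
  have hreg : ∀ᶠ p in L, x p.1 ≤ p.2 :=
    eventually_inf_principal.2 (Eventually.of_forall fun _ => id)
  have hy : Tendsto Prod.snd L atTop := tendsto_atTop_mono' L hreg (hx.comp hT)
  have hΓβ : 0 < Real.Gamma (1 - β) := Real.Gamma_pos_of_pos (by linarith)
  have hΓγ : 0 < Real.Gamma (1 - γ) := Real.Gamma_pos_of_pos (by linarith)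
  have hγβ : γ * β < 1 := by nlinarith
  have hΓγβ : 0 < Real.Gamma (1 - γ * β) := Real.Gamma_pos_of_pos (by linarith)
  have hqd : ∀ᶠ p in L, F p.2 ≤ K * (1 - z p.1) := by
    filter_upwards [hreg, hT.eventually hKz] with p h1 h2 using (hFanti h1).trans h2
  have hq0 : Tendsto (fun p : ℝ≥0 × ℝ => F p.2) L (𝓝 0) := by
    have hz0 : Tendsto (fun p : ℝ≥0 × ℝ => K * (1 - z p.1)) L (𝓝 0) := by
      have := ((tendsto_const_nhds (x := (1:ℝ))).sub (hz1.comp hT)).const_mul K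
      simpa using this
    exact tendsto_of_tendsto_of_tendsto_of_le_of_le' tendsto_const_nhds hz0
      (Eventually.of_forall fun p => (hFpos _).le) hqd
  -- Common normalisation of numerator and denominator; it cancels in the ratio, so its own limit is
  -- irrelevant.
  set a : ℝ≥0 × ℝ → ℝ := fun p => C p.1 * F p.2 ^ γ with ha
  have ha0 : ∀ p, 0 < a p := fun p => mul_pos (hC _) (Real.rpow_pos_of_pos (hFpos _) _)
  have hgen : ∀ (u : ℝ≥0 × ℝ → ℝ) (κ : ℝ), 0 < κ → (∀ p, u p ≤ 1) →
      Tendsto (fun p => u p / F p.2) L (𝓝 κ) →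
      Tendsto (fun p => (1 - genFun μ (N p.1) (1 - u p)) / a p) L (𝓝 (κ ^ γ)) := by
    intro u κ hκ hu1 hu
    have hφL : ∀ p : ℝ≥0 × ℝ, ∀ w : ℝ, 0 ≤ w → w < 1 →
      genFun μ (N p.1) w = 1 - C p.1 * (1 - w) ^ γ + err p.1 (1 - w) := fun p => hφ p.1
    have herrL := fun r hr => (herr r hr).comp hT
    have hlim := @tendsto_one_sub_genFun_div (ℝ≥0 × ℝ) L (fun p => genFun μ (N p.1))
      (fun p => err p.1) (fun p => C p.1) (fun p => 1 - z p.1) (fun p => F p.2) u γ κ K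
      (fun p => hC p.1) (fun p => hFpos p.2) hκ hφL herrL hK hqd hu1 hu
    exact hlim
  clear_value a L
  have hNr : ∀ t, Measurable fun ω => (N t ω : ℝ) := fun t => measurable_from_nat.comp (hNm t)
  have hden : Tendsto (fun p : ℝ≥0 × ℝ =>
      tailFun μ (fun ω => F p.2 * (N p.1 ω : ℝ)) 1 / a p) L (𝓝 (1 / Real.Gamma (1 - γ))) := by
    have hmgf : ∀ s > 0, Tendsto (fun p : ℝ≥0 × ℝ =>
        (1 - mgf (fun ω => F p.2 * (N p.1 ω : ℝ)) μ (-s)) / a p) L (𝓝 (1 * s ^ γ)) := by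
      intro s hs
      rw [one_mul]
      refine (hgen (fun p => 1 - Real.exp (-(s * F p.2))) s hs
        (fun p => sub_le_self _ (Real.exp_pos _).le)
        (tendsto_one_sub_exp_neg_mul_div (fun p => hFpos _) hq0 s)).congr fun p => ?_
      rw [mgf_mul_natCast μ (hNm p.1) (hFpos _).le hs.le, sub_sub_cancel]
    have hVm : ∀ p : ℝ≥0 × ℝ, Measurable fun ω => F p.2 * (N p.1 ω : ℝ) :=
      fun p => (hNr p.1).const_mul (F p.2)
    have hV0 : ∀ p : ℝ≥0 × ℝ, ∀ᵐ ω ∂μ, 0 ≤ F p.2 * (N p.1 ω : ℝ) :=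
      fun p => Eventually.of_forall fun ω => mul_nonneg (hFpos p.2).le (Nat.cast_nonneg _)
    exact tendsto_tailFun_of_tendsto_mgf μ hVm hV0 (fun p => (ha0 p).le) hγ0 hγ1 zero_le_one hmgf
  -- The absolute value keeps the rescaled sum nonnegative for every pair, as the Tauberian theorem
  -- asks; along `L` the second coordinate is eventually positive.
  have hnum : Tendsto (fun p : ℝ≥0 × ℝ =>
      tailFun μ (fun ω => |p.2|⁻¹ * randomSum X (N p.1) ω) 1 / a p) L
      (𝓝 (Real.Gamma (1 - β) ^ γ / Real.Gamma (1 - γ * β))) := by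
    have hmgf : ∀ s > 0, Tendsto (fun p : ℝ≥0 × ℝ =>
        (1 - mgf (fun ω => |p.2|⁻¹ * randomSum X (N p.1) ω) μ (-s)) / a p) L
        (𝓝 (Real.Gamma (1 - β) ^ γ * s ^ (γ * β))) := by
      intro s hs
      have habel := tendsto_one_sub_mgf_div_tailFun μ (hXm 0) (hX0 0) hβ0 hβ1 hXrv hs
      have hlim := hgen (fun p => 1 - mgf (X 0) μ (-(s / |p.2|))) _
        (mul_pos hΓβ (Real.rpow_pos_of_pos hs β)) (fun p => sub_le_self _ mgf_nonneg)
        ((habel.comp hy).congr' (by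
          filter_upwards [hy.eventually_gt_atTop 0] with p hp
          simp only [Function.comp_apply, abs_of_pos hp, hF]))
      rw [Real.mul_rpow hΓβ.le (by positivity), ← Real.rpow_mul hs.le, mul_comm β γ] at hlim
      refine hlim.congr fun p => ?_
      rw [mgf_const_mul, show |p.2|⁻¹ * -s = -(s / |p.2|) by ring,
        mgf_randomSum μ hXm hX0 hXind hXid (hNm p.1) (hNX p.1) (by positivity), sub_sub_cancel]
    have hVm : ∀ p : ℝ≥0 × ℝ, Measurable fun ω => |p.2|⁻¹ * randomSum X (N p.1) ω :=
      fun p => (measurable_randomSum hXm (hNm p.1)).const_mul |p.2|⁻¹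
    have hV0 : ∀ p : ℝ≥0 × ℝ, ∀ᵐ ω ∂μ, 0 ≤ |p.2|⁻¹ * randomSum X (N p.1) ω :=
      fun p => (randomSum_nonneg hX0 (N p.1)).mono fun ω hω => mul_nonneg (by positivity) hω
    exact tendsto_tailFun_of_tendsto_mgf μ hVm hV0 (fun p => (ha0 p).le) (by positivity) hγβ
      (by positivity) hmgf
  have hratio : Tendsto (fun p : ℝ≥0 × ℝ => |μ.real {ω | p.2 < randomSum X (N p.1) ω} /
      (stoppedConst γ β * μ.real {ω | 1 < F p.2 * (N p.1 ω : ℝ)}) - 1|) L (𝓝 0) := by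
    have hconst : stoppedConst γ β ≠ 0 := by
      unfold stoppedConst
      positivity
    have h := (hnum.div (hden.const_mul (stoppedConst γ β))
      (mul_ne_zero hconst (by positivity))).sub_const 1
    have hone : Real.Gamma (1 - β) ^ γ / Real.Gamma (1 - γ * β) /
        (stoppedConst γ β * (1 / Real.Gamma (1 - γ))) - 1 = 0 := by
      have : 0 < Real.Gamma (1 - β) ^ γ := Real.rpow_pos_of_pos hΓβ _
      have hmul : stoppedConst γ β * (1 / Real.Gamma (1 - γ)) =
          Real.Gamma (1 - β) ^ γ / Real.Gamma (1 - γ * β) := by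
        unfold stoppedConst
        field_simp
      rw [hmul, div_self (by positivity), sub_self]
    rw [hone] at h
    refine ((tendsto_zero_iff_abs_tendsto_zero _).1 h).congr' ?_
    filter_upwards [hy.eventually_gt_atTop 0] with p hp
    have hset : {ω | p.2 < randomSum X (N p.1) ω} =
        {ω | 1 < |p.2|⁻¹ * randomSum X (N p.1) ω} := by
      ext ω
      simp only [Set.mem_ofPred_eq]
      rw [abs_of_pos hp, inv_mul_eq_div, one_lt_div hp]
    have hap := (ha0 p).ne'
    simp only [Function.comp_apply, Pi.div_apply, tailFun, hset]
    rw [← mul_div_assoc, div_div_div_cancel_right₀ hap]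
  rw [ENNReal.tendsto_nhds_zero]
  intro ε hε
  have hof : Tendsto (fun p : ℝ≥0 × ℝ => ENNReal.ofReal
      |μ.real {ω | p.2 < randomSum X (N p.1) ω} /
      (stoppedConst γ β * μ.real {ω | 1 < F p.2 * (N p.1 ω : ℝ)}) - 1|) L (𝓝 0) := by
    simpa using ENNReal.tendsto_ofReal hratio
  rw [hL] at hof
  -- Unfolding `L`: for all large t the bound holds for every y ≥ x t at once, which bounds the
  -- supremum.
  have hev := eventually_comap.1 (eventually_inf_principal.1
    (ENNReal.tendsto_nhds_zero.1 hof ε hε))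
  filter_upwards [hev] with t ht
  exact iSup₂_le fun y hy => ht (t, y) rfl hy
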